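/- Let $n\in\mathbb{N}$ and $\mathbb{T}=\mathbb{R}\cup\{-\infty\}$, with its usual order, with addition extended by $(-\infty)+a=a+(-\infty)=-\infty$, and with the topology of the distance $(a,b)\mapsto|\exp(a)-\exp(b)|$, where $\exp(-\infty)=0$. Equip $\mathbb{T}^n$ with the entrywise order and the product topology. For $\beta\in\mathbb{T}$ and $z\in\mathbb{T}^n$ let $\beta+z$ be the vector with entries $\beta+z_i$. Let $F\colon\mathbb{T}^n\to\mathbb{T}^n$ be continuous, order-preserving ($x\le y$ implies $F(x)\le F(y)$) and additively homogeneous ($F(\lambda+x)=\lambda+F(x)$ for all $\lambda\in\mathbb{T}$, $x\in\mathbb{T}^n$). For a self-map $G$ of $\mathbb{T}^n$, say that $\mathscr{P}(G)$ is feasible if there is $x\in\mathbb{T}^n$ with $x\neq(-\infty,\dots,-\infty)$ and $x\le G(x)$, and that $\mathscr{P}_{\mathbb{R}}(G)$ is feasible if there is $x\in\mathbb{R}^n$ with $x_i<G_i(x)$ for all $i$; otherwise the problem is infeasible. For $u\in\mathbb{R}^n$ let $u+F$ be the map $x\mapsto u+F(x)$ (entrywise addition), and let $\|u\|_\infty$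 be the sup-norm of $u$. Define $\operatorname{cond}(F)\in[0,+\infty]$ by $$\operatorname{cond}(F)=\begin{cases}\bigl(\inf\{\|u\|_\infty: u\in\mathbb{R}^n,\ \mathscr{P}(u+F)\text{ is infeasible}\}\bigr)^{-1}&\text{if }\mathscr{P}(F)\text{ is feasible},\\ \bigl(\inf\{\|u\|_\infty: u\in\mathbb{R}^n,\ \mathscr{P}(u+F)\text{ is feasible}\}\bigr)^{-1}&\text{if }\mathscr{P}(F)\text{ is infeasible},\end{cases}$$ and define $\operatorname{cond}_{\mathbb{R}}(F)$ in the same way with $\mathscr{P}_{\mathbb{R}}$ in place of $\mathscr{P}$. Define the upper and lower Collatz--Wielandt numbers of $F$, as elements of $[-\infty,+\infty]$, by $$\overline{\mathrm{cw}}(F)=\inf\{\mu\in\mathbb{R}:\exists z\in\mathbb{R}^n,\ F(z)\le\mu+z\},\qquad \underline{\mathrm{cw}}(F)=\sup\{\mu\in\mathbb{R}:\exists z\in\mathbb{R}^n,\ F(z)\ge\mu+z\}.$$ The conventions are $\inf\emptyset=+\infty$, $\sup\emptyset=-\infty$, $|\pm\infty|=+\infty$, $0^{-1}=+\infty$ and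 $(+\infty)^{-1}=0$. Then $$\operatorname{cond}_{\mathbb{R}}(F)=|\underline{\mathrm{cw}}(F)|^{-1}\qquad\text{and}\qquad\operatorname{cond}(F)=|\overline{\mathrm{cw}}(F)|^{-1}.$$ -/

import Mathlib

open scoped ENNReal

/-- The carrier `ℝ ∪ {-∞}` of the tropical (max-plus) semifield. -/
def Trop : Type := WithBot ℝ

namespace Trop

noncomputable section

instance : LinearOrder Trop := inferInstanceAs (LinearOrder (WithBot ℝ))

/-- The bottom element `-∞`. -/
instance : OrderBot Trop := inferInstanceAs (OrderBot (WithBot ℝ))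

/-- The usual addition of `ℝ ∪ {-∞}` (the tropical multiplication), with `-∞` absorbing. -/
instance : AddCommMonoid Trop := inferInstanceAs (AddCommMonoid (WithBot ℝ))

/-- The inclusion of `ℝ` in `ℝ ∪ {-∞}`. -/
@[coe] def ofReal (r : ℝ) : Trop := WithBot.some r

instance : Coe ℝ Trop := ⟨ofReal⟩

/-- The exponential on `ℝ ∪ {-∞}`, with `exp (-∞) = 0`. -/
def exp (x : Trop) : ℝ := WithBot.recBotCoe (C := fun _ => ℝ) 0 Real.exp x

theorem exp_bot : exp ⊥ = 0 := rfl

theorem exp_ofReal (r : ℝ) : exp (r : Trop) = Real.exp r := rfl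

theorem exp_injective : Function.Injective exp := by
  intro x y h
  induction x using WithBot.recBotCoe with
  | bot =>
    induction y using WithBot.recBotCoe with
    | bot => rfl
    | coe b => exact absurd h (Real.exp_pos b).ne
  | coe a =>
    induction y using WithBot.recBotCoe with
    | bot => exact absurd h (Real.exp_pos a).ne'
    | coe b => exact congrArg ofReal (Real.exp_injective h)

/-- The metric `(a, b) ↦ |exp a - exp b|` on `ℝ ∪ {-∞}`. -/
instance : MetricSpace Trop := MetricSpace.induced exp exp_injective inferInstance

theorem dist_eq (a b : Trop) : dist a b = |exp a - exp b| := rfl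

/-- The entrywise inclusion of `ℝⁿ` in `(ℝ ∪ {-∞})ⁿ`. -/
def ofVec {n : ℕ} (z : Fin n → ℝ) : Fin n → Trop := fun i => (z i : Trop)

/-- The translate `β + z` of a vector by a scalar. -/
def shift {n : ℕ} (β : Trop) (z : Fin n → Trop) : Fin n → Trop := fun i => β + z i

/-- `F (β + x) = β + F x` for all scalars `β` (including `-∞`) and all vectors `x`. -/
def AddHomogeneous {n : ℕ} (F : (Fin n → Trop) → (Fin n → Trop)) : Prop :=
  ∀ (β : Trop) (x : Fin n → Trop), F (shift β x) = shift β (F x)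

/-- The perturbed map `u + F : x ↦ u + F x`, for `u ∈ ℝⁿ`. -/
def perturb {n : ℕ} (u : Fin n → ℝ) (F : (Fin n → Trop) → (Fin n → Trop)) :
    (Fin n → Trop) → (Fin n → Trop) :=
  fun x => ofVec u + F x

/-- Feasibility of `P(F)`: some `x ∈ (ℝ ∪ {-∞})ⁿ`, not identically `-∞`, satisfies `x ≤ F x`. -/
def Feasible {n : ℕ} (F : (Fin n → Trop) → (Fin n → Trop)) : Prop :=
  ∃ x : Fin n → Trop, x ≠ ⊥ ∧ x ≤ F x

/-- Feasibility of `P_ℝ(F)`: some `x ∈ ℝⁿ` satisfies `x i < F x i` for all `i`. -/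
def FeasibleReal {n : ℕ} (F : (Fin n → Trop) → (Fin n → Trop)) : Prop :=
  ∃ x : Fin n → ℝ, ∀ i, (x i : Trop) < F (ofVec x) i

open Classical in
/-- The condition number of a feasibility problem `P`, at `F`: the inverse of the infimum of the
sup-norms of the perturbations `u ∈ ℝⁿ` for which the feasibility status of `u + F` is the
opposite of that of `F`. It takes values in `[0, +∞]`; the infimum over the empty set
is `+∞`, and `0⁻¹ = +∞`, `(+∞)⁻¹ = 0`. -/
def condOf {n : ℕ} (P : ((Fin n → Trop) → (Fin n → Trop)) → Prop)
    (F : (Fin n → Trop) → (Fin n → Trop)) : ℝ≥0∞ :=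
  if P F then
    (sInf {r : ℝ≥0∞ | ∃ u : Fin n → ℝ, ¬ P (perturb u F) ∧ r = ENNReal.ofReal ‖u‖})⁻¹
  else
    (sInf {r : ℝ≥0∞ | ∃ u : Fin n → ℝ, P (perturb u F) ∧ r = ENNReal.ofReal ‖u‖})⁻¹

/-- The condition number of `P(F)`. -/
def cond {n : ℕ} (F : (Fin n → Trop) → (Fin n → Trop)) : ℝ≥0∞ := condOf Feasible F

/-- The condition number of `P_ℝ(F)`. -/
def condReal {n : ℕ} (F : (Fin n → Trop) → (Fin n → Trop)) : ℝ≥0∞ := condOf FeasibleReal F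

/-- The upper Collatz–Wielandt number, an infimum in `[-∞, +∞]`. -/
def upperCW {n : ℕ} (F : (Fin n → Trop) → (Fin n → Trop)) : EReal :=
  sInf {m : EReal | ∃ μ : ℝ, m = (μ : EReal) ∧
    ∃ z : Fin n → ℝ, F (ofVec z) ≤ shift (μ : Trop) (ofVec z)}

/-- The lower Collatz–Wielandt number, a supremum in `[-∞, +∞]`. -/
def lowerCW {n : ℕ} (F : (Fin n → Trop) → (Fin n → Trop)) : EReal :=
  sSup {m : EReal | ∃ μ : ℝ, m = (μ : EReal) ∧
    ∃ z : Fin n → ℝ, shift (μ : Trop) (ofVec z) ≤ F (ofVec z)}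

end

end Trop

namespace Trop

noncomputable section

open Filter Topology

variable {n : ℕ}

/-! Since `-‖u‖ ≤ u ≤ ‖u‖` entrywise and feasibility increases with `u`, only constant perturbations
`r` matter; `condOf_eq_inv_abs` then reads the condition number off the threshold value of `r`. For
the real problem that threshold is the negated lower Collatz–Wielandt number almost by definition.
For the other one it is the negated upper number, by a duality: `le_of_subeigenvector` (weak)
compares sub- and supereigenvectors, and `exists_strict_supereigenvector` (strong) gets a strict
certificate from infeasibility. Inequalities are checked through `exp`, where shifts become
products. -/

theorem exp_add (a b : Trop) : exp (a + b) = exp a * exp b := by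
  induction a using WithBot.recBotCoe with
  | bot =>
    exact (congrArg exp (WithBot.bot_add (b : WithBot ℝ))).trans (zero_mul (exp b)).symm
  | coe a =>
    induction b using WithBot.recBotCoe with
    | bot => exact (mul_zero _).symm
    | coe b => exact Real.exp_add a b

theorem exp_le_exp {a b : Trop} : exp a ≤ exp b ↔ a ≤ b := by
  induction a using WithBot.recBotCoe with
  | bot =>
    refine iff_of_true ?_ (bot_le (α := Trop))
    induction b using WithBot.recBotCoe with
    | bot => exact le_rfl
    | coe b => exact (Real.exp_pos b).le
  | coe a =>
    induction b using WithBot.recBotCoe with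
    | bot =>
      exact iff_of_false (not_le.2 (Real.exp_pos a)) (WithBot.not_coe_le_bot a)
    | coe b => exact Real.exp_le_exp.trans WithBot.coe_le_coe.symm

theorem exp_lt_exp {a b : Trop} : exp a < exp b ↔ a < b :=
  lt_iff_lt_of_le_iff_le exp_le_exp

theorem exp_nonneg (a : Trop) : 0 ≤ exp a :=
  exp_le_exp.2 (bot_le (a := a))

theorem isInducing_exp : IsInducing exp := ⟨rfl⟩

theorem continuous_exp : Continuous exp := isInducing_exp.continuous

/-- The inverse of `exp`, extended by `-∞` to the negative reals. -/
def log (t : ℝ) : Trop := if 0 < t then (Real.log t : Trop) else ⊥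

theorem exp_log {t : ℝ} (ht : 0 ≤ t) : exp (log t) = t := by
  rcases ht.eq_or_lt with rfl | h
  · simp [log, exp_bot]
  · simp [log, h, exp_ofReal, Real.exp_log h]

theorem log_of_pos {t : ℝ} (ht : 0 < t) : log t = (Real.log t : Trop) := if_pos ht

theorem continuousOn_log : ContinuousOn log (Set.Ici 0) := by
  rw [isInducing_exp.continuousOn_iff]
  exact continuousOn_id.congr fun t ht => exp_log ht

theorem shift_mono (β : Trop) {x y : Fin n → Trop} (h : x ≤ y) : shift β x ≤ shift β y := by
  intro i
  rw [← exp_le_exp]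
  simp only [shift, exp_add]
  exact mul_le_mul_of_nonneg_left (exp_le_exp.2 (h i)) (exp_nonneg _)

theorem exp_perturb (u : Fin n → ℝ) (F : (Fin n → Trop) → (Fin n → Trop)) (x : Fin n → Trop)
    (i : Fin n) : exp (perturb u F x i) = Real.exp (u i) * exp (F x i) :=
  exp_add _ _

theorem perturb_zero (F : (Fin n → Trop) → (Fin n → Trop)) : perturb 0 F = F := by
  funext x i
  apply exp_injective
  simp [exp_perturb]

theorem perturb_le_perturb {u v : Fin n → ℝ} (h : u ≤ v) (F : (Fin n → Trop) → (Fin n → Trop))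
    (x : Fin n → Trop) : perturb u F x ≤ perturb v F x := by
  intro i
  rw [← exp_le_exp, exp_perturb, exp_perturb]
  exact mul_le_mul_of_nonneg_right (Real.exp_le_exp.2 (h i)) (exp_nonneg _)

theorem continuous_perturb (u : Fin n → ℝ) {F : (Fin n → Trop) → (Fin n → Trop)}
    (hF : Continuous F) : Continuous (perturb u F) := by
  refine continuous_pi fun i => isInducing_exp.continuous_iff.2 ?_
  refine Continuous.congr ?_ fun x => (exp_perturb u F x i).symm
  exact continuous_const.mul (continuous_exp.comp ((continuous_apply i).comp hF))

theorem monotone_perturb (u : Fin n → ℝ) {F : (Fin n → Trop) → (Fin n → Trop)}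
    (hF : Monotone F) : Monotone (perturb u F) := by
  intro x y h i
  rw [← exp_le_exp, exp_perturb, exp_perturb]
  exact mul_le_mul_of_nonneg_left (exp_le_exp.2 (hF h i)) (Real.exp_pos _).le

/-! ### Reduction to constant perturbations -/

/-- A problem whose feasibility increases with the perturbation, and whose threshold for constant
perturbations is `-c`, has condition number `|c|⁻¹`. -/
theorem condOf_eq_inv_abs {P : ((Fin n → Trop) → (Fin n → Trop)) → Prop}
    {F : (Fin n → Trop) → (Fin n → Trop)} {c : EReal}
    (hP : ∀ u v : Fin n → ℝ, u ≤ v → P (perturb u F) → P (perturb v F))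
    (hle : ∀ r : ℝ, P (perturb (fun _ => r) F) → ((-r : ℝ) : EReal) ≤ c)
    (hlt : ∀ r : ℝ, ((-r : ℝ) : EReal) < c → P (perturb (fun _ => r) F)) :
    condOf P F = c.abs⁻¹ := by
  have hzero : perturb (fun _ => 0) F = F := perturb_zero F
  have hnorm : ∀ (u : Fin n → ℝ) (i : Fin n), |u i| ≤ ‖u‖ := fun u i => norm_le_pi_norm u i
  -- Not an equality: for `n = 0` the norm is `0`.
  have hconst : ∀ r : ℝ, 0 ≤ r → ‖(fun _ : Fin n => r)‖ ≤ r := fun r hr =>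
    (pi_norm_const_le r).trans (by rw [Real.norm_of_nonneg hr])
  unfold condOf
  split_ifs with h
  · congr 1
    have hc : 0 ≤ c := by simpa using hle 0 (by rwa [hzero])
    apply le_antisymm
    · induction c with
      | bot => simp
      | top => simp
      | coe c =>
        have hc' : 0 ≤ c := by exact_mod_cast hc
        refine ENNReal.le_of_forall_pos_le_add fun ε hε _ => ?_
        -- The threshold itself may be feasible, so step `ε` beyond it.
        refine le_trans (sInf_le ⟨fun _ => -(c + ε), ?_, rfl⟩) ?_
        · intro hcon
          have := hle _ hcon
          rw [EReal.coe_le_coe_iff] at this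
          have : (0 : ℝ) < ε := hε
          linarith
        · rw [EReal.abs_def, abs_of_nonneg hc', ← ENNReal.ofReal_coe_nnreal (p := ε),
            ← ENNReal.ofReal_add hc' ε.coe_nonneg]
          apply ENNReal.ofReal_le_ofReal
          have := hconst (c + ε) (by positivity)
          rwa [← norm_neg] at this
    · refine le_sInf ?_
      rintro _ ⟨u, hu, rfl⟩
      have hu' : ¬ P (perturb (fun _ => -‖u‖) F) := fun hcon =>
        hu (hP _ _ (fun i => (abs_le.1 (hnorm u i)).1) hcon)
      have hcu : c ≤ (‖u‖ : ℝ) := by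
        by_contra! hcon
        exact hu' (hlt _ (by simpa using hcon))
      induction c with
      | bot => simp at hc
      | top => simp at hcu
      | coe c =>
        have hc' : 0 ≤ c := by exact_mod_cast hc
        rw [EReal.abs_def, abs_of_nonneg hc']
        exact ENNReal.ofReal_le_ofReal (by exact_mod_cast hcu)
  · congr 1
    have hc : c ≤ 0 := by
      by_contra! hcon
      exact h (hzero ▸ hlt 0 (by simpa using hcon))
    apply le_antisymm
    · induction c with
      | bot => simp
      | top => simp
      | coe c =>
        have hc' : c ≤ 0 := by exact_mod_cast hc
        refine ENNReal.le_of_forall_pos_le_add fun ε hε _ => ?_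
        have hε' : (0 : ℝ) < ε := hε
        refine le_trans (sInf_le ⟨fun _ => -c + ε, ?_, rfl⟩) ?_
        · apply hlt
          rw [EReal.coe_lt_coe_iff]
          linarith
        · rw [EReal.abs_def, abs_of_nonpos hc', ← ENNReal.ofReal_coe_nnreal (p := ε),
            ← ENNReal.ofReal_add (neg_nonneg.2 hc') ε.coe_nonneg]
          exact ENNReal.ofReal_le_ofReal (hconst _ (by linarith))
    · refine le_sInf ?_
      rintro _ ⟨u, hu, rfl⟩
      have hcu := hle ‖u‖ (hP _ _ (fun i => (abs_le.1 (hnorm u i)).2) hu)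
      induction c with
      | bot => simp at hcu
      | top => simp at hc
      | coe c =>
        have hc' : c ≤ 0 := by exact_mod_cast hc
        rw [EReal.coe_le_coe_iff] at hcu
        rw [EReal.abs_def, abs_of_nonpos hc']
        exact ENNReal.ofReal_le_ofReal (by linarith)

/-- Strict and weak inequalities differ by an arbitrarily small change of `μ`, invisible to the
supremum. -/
theorem condReal_eq (F : (Fin n → Trop) → (Fin n → Trop)) :
    condReal F = (lowerCW F).abs⁻¹ := by
  apply condOf_eq_inv_abs
  · rintro u v h ⟨x, hx⟩
    exact ⟨x, fun i => (hx i).trans_le (perturb_le_perturb h F _ i)⟩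
  · rintro r ⟨x, hx⟩
    refine le_sSup ⟨-r, rfl, x, fun i => ?_⟩
    have := exp_lt_exp.2 (hx i)
    rw [exp_perturb] at this
    rw [← exp_le_exp, shift, exp_add, exp_ofReal, Real.exp_neg, inv_mul_le_iff₀ (Real.exp_pos _)]
    exact this.le
  · intro r hr
    obtain ⟨_, ⟨μ, rfl, z, hz⟩, hμ⟩ := lt_sSup_iff.1 hr
    refine ⟨z, fun i => ?_⟩
    have := exp_le_exp.2 (hz i)
    rw [shift, exp_add, exp_ofReal] at this
    rw [← exp_lt_exp, exp_perturb, ← inv_mul_lt_iff₀ (Real.exp_pos _), ← Real.exp_neg]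
    refine lt_of_lt_of_le ?_ this
    refine mul_lt_mul_of_pos_right (Real.exp_lt_exp.2 ?_) (Real.exp_pos (z i))
    exact_mod_cast hμ

/-! ### Duality for the upper Collatz–Wielandt number -/

/-- A Collatz–Wielandt upper bound on a real vector bounds every subeigenvalue. -/
theorem le_of_subeigenvector {F : (Fin n → Trop) → (Fin n → Trop)} (hmono : Monotone F)
    (hhom : AddHomogeneous F) {r μ : ℝ} {x : Fin n → Trop} (hx0 : x ≠ ⊥)
    (hx : shift (r : Trop) x ≤ F x) {z : Fin n → ℝ}
    (hz : F (ofVec z) ≤ shift (μ : Trop) (ofVec z)) : r ≤ μ := by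
  obtain ⟨j, hj⟩ : ∃ j, x j ≠ ⊥ := by
    by_contra! hcon
    exact hx0 (funext hcon)
  -- `log t` is the least scalar with `x ≤ log t + z`, and equality holds at `i`; there the two
  -- bounds on `F x` can be compared.
  obtain ⟨i, -, hi⟩ := Finset.exists_max_image Finset.univ
    (fun i => exp (x i) * Real.exp (-z i)) ⟨j, Finset.mem_univ j⟩
  set t := exp (x i) * Real.exp (-z i) with ht
  have hjpos : 0 < exp (x j) :=
    (exp_nonneg _).lt_of_ne fun h => hj (exp_injective (h.symm.trans exp_bot.symm))
  have htpos : 0 < t := (mul_pos hjpos (Real.exp_pos _)).trans_le (hi j (Finset.mem_univ j))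
  have hcancel : ∀ k, Real.exp (-z k) * Real.exp (z k) = 1 := fun k => by
    rw [← Real.exp_add]; simp
  have hxz : x ≤ shift (log t) (ofVec z) := by
    intro k
    rw [← exp_le_exp, shift, exp_add, exp_log htpos.le]
    calc exp (x k) = exp (x k) * Real.exp (-z k) * Real.exp (z k) := by
          rw [mul_assoc, hcancel, mul_one]
      _ ≤ t * Real.exp (z k) :=
          mul_le_mul_of_nonneg_right (hi k (Finset.mem_univ k)) (Real.exp_pos _).le
  have key : shift (r : Trop) x ≤ shift (log t) (shift (μ : Trop) (ofVec z)) :=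
    hx.trans ((hmono hxz).trans (by rw [hhom]; exact shift_mono _ hz))
  have h := exp_le_exp.2 (key i)
  simp only [shift, exp_add, exp_log htpos.le, exp_ofReal, ofVec] at h
  have hxi : exp (x i) = t * Real.exp (z i) := by rw [ht, mul_assoc, hcancel, mul_one]
  rw [hxi] at h
  have hpos : 0 < t * Real.exp (z i) := mul_pos htpos (Real.exp_pos _)
  exact Real.exp_le_exp.1 (le_of_mul_le_mul_right (by linarith) hpos)

/-- In exponential coordinates, the truncation of `(1 + ε) F` to `[ε, 1]` has a fixed point. -/
theorem exists_truncated_fixedPoint {F : (Fin n → Trop) → (Fin n → Trop)} (hmono : Monotone F)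
    {ε : ℝ} (hε : 0 < ε) : ∃ x : Fin n → ℝ, x ∈ Set.Icc 0 1 ∧
      ∀ i, min 1 (max ((1 + ε) * exp (F (fun j => log (x j)) i)) ε) = x i := by
  -- Knaster–Tarski on the complete lattice `[0, 1]ⁿ`: monotonicity suffices.
  let g : (Fin n → unitInterval) →o (Fin n → unitInterval) :=
    { toFun := fun x i => ⟨min 1 (max ((1 + ε) * exp (F (fun j => log (x j)) i)) ε),
        le_min zero_le_one (hε.le.trans (le_max_right _ _)), min_le_left _ _⟩
      monotone' := by
        intro x y h i
        refine Subtype.mk_le_mk.2 (min_le_min_left _ (max_le_max_right _ ?_))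
        refine mul_le_mul_of_nonneg_left (exp_le_exp.2 (hmono (fun j => ?_) i)) (by linarith)
        rw [← exp_le_exp, exp_log (x j).2.1, exp_log (y j).2.1]
        exact h j }
  refine ⟨fun i => (g.lfp i : ℝ), ⟨fun i => (g.lfp i).2.1, fun i => (g.lfp i).2.2⟩, fun i => ?_⟩
  exact congrArg Subtype.val (congrFun g.map_lfp i)

/-- Take truncated fixed points as `ε → 0`. If one never touches the ceiling `1`, it satisfies `(1 +
ε) exp F ≤ x`, a strict certificate. If all touch it, a limit point is nonzero and gives a solution
of `x ≤ F x`. -/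
theorem exists_strict_supereigenvector {F : (Fin n → Trop) → (Fin n → Trop)}
    (hcont : Continuous F) (hmono : Monotone F) (hF : ¬ Feasible F) :
    ∃ μ : ℝ, μ < 0 ∧ ∃ z : Fin n → ℝ, F (ofVec z) ≤ shift (μ : Trop) (ofVec z) := by
  let ε : ℕ → ℝ := fun k => 1 / ((k : ℝ) + 1)
  have hε : ∀ k, 0 < ε k := fun k => Nat.one_div_pos_of_nat
  choose x hx hfix using fun k => exists_truncated_fixedPoint hmono (hε k)
  by_cases hone : ∀ k, ∃ i, x k i = 1
  · exfalso
    obtain ⟨a, ha, φ, hφ, hlim⟩ := (isCompact_Icc (a := (0 : Fin n → ℝ)) (b := 1)).tendsto_subseq hx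
    have hεlim : Tendsto (fun k => ε (φ k)) atTop (𝓝 0) :=
      tendsto_one_div_add_atTop_nhds_zero_nat.comp hφ.tendsto_atTop
    have hlim' : ∀ i, Tendsto (fun k => x (φ k) i) atTop (𝓝 (a i)) := tendsto_pi_nhds.1 hlim
    have hlog : Tendsto (fun k j => log (x (φ k) j)) atTop (𝓝 fun j => log (a j)) := by
      refine tendsto_pi_nhds.2 fun j => (continuousOn_log (a j) (ha.1 j)).tendsto.comp ?_
      exact tendsto_nhdsWithin_iff.2 ⟨hlim' j, Eventually.of_forall fun k => (hx (φ k)).1 j⟩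
    have hFlim : ∀ i, Tendsto (fun k => exp (F (fun j => log (x (φ k) j)) i)) atTop
        (𝓝 (exp (F (fun j => log (a j)) i))) := fun i =>
      ((continuous_exp.comp ((continuous_apply i).comp hcont)).tendsto _).comp hlog
    refine hF ⟨fun j => log (a j), ?_, fun i => ?_⟩
    -- The coordinate equal to `1` may vary with `k`, hence the finite union.
    · have hclosed : IsClosed {y : Fin n → ℝ | ∃ i, y i = 1} := by
        simp only [Set.ofPred_exists]
        exact isClosed_iUnion_of_finite fun i => isClosed_eq (continuous_apply i) continuous_const
      obtain ⟨i, hi⟩ := hclosed.mem_of_tendsto hlim (Eventually.of_forall fun k => hone (φ k))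
      intro hbot
      have := congrArg exp (congrFun hbot i)
      rw [exp_log (ha.1 i), hi] at this
      exact one_ne_zero (this.trans exp_bot)
    · have h1 : Tendsto (fun k => x (φ k) i) atTop
          (𝓝 (min 1 (max ((1 + 0) * exp (F (fun j => log (a j)) i)) 0))) := by
        refine Tendsto.congr (fun k => hfix (φ k) i) ?_
        exact tendsto_const_nhds.min (((tendsto_const_nhds.add hεlim).mul (hFlim i)).max hεlim)
      have h2 := tendsto_nhds_unique (hlim' i) h1
      rw [← exp_le_exp, exp_log (ha.1 i), h2]
      refine (min_le_right _ _).trans (max_le (by simp) (exp_nonneg _))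
  · push Not at hone
    obtain ⟨k, hk⟩ := hone
    have hmax : ∀ i, max ((1 + ε k) * exp (F (fun j => log (x k j)) i)) (ε k) = x k i := by
      intro i
      rcases min_choice 1 (max ((1 + ε k) * exp (F (fun j => log (x k j)) i)) (ε k)) with h | h
      · exact absurd ((hfix k i).symm.trans h) (hk i)
      · exact h.symm.trans (hfix k i)
    -- The floor `ε` is what makes `z` real.
    have hpos : ∀ i, 0 < x k i := fun i => (hε k).trans_le ((le_max_right _ _).trans_eq (hmax i))
    have hε1 : 0 < 1 + ε k := by linarith [hε k]
    refine ⟨-Real.log (1 + ε k), neg_lt_zero.2 (Real.log_pos (by linarith [hε k])),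
      fun i => Real.log (x k i), fun i => ?_⟩
    have hvec : ofVec (fun i => Real.log (x k i)) = fun j => log (x k j) :=
      funext fun j => (log_of_pos (hpos j)).symm
    rw [hvec, ← exp_le_exp, shift, exp_add, exp_log (hpos i).le, exp_ofReal, Real.exp_neg,
      Real.exp_log hε1, ← div_eq_inv_mul, le_div_iff₀' hε1]
    exact (le_max_left _ _).trans_eq (hmax i)

theorem cond_eq {F : (Fin n → Trop) → (Fin n → Trop)} (hcont : Continuous F) (hmono : Monotone F)
    (hhom : AddHomogeneous F) : cond F = (upperCW F).abs⁻¹ := by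
  apply condOf_eq_inv_abs
  · rintro u v h ⟨x, hx0, hx⟩
    exact ⟨x, hx0, hx.trans (perturb_le_perturb h F _)⟩
  · rintro r ⟨x, hx0, hx⟩
    refine le_sInf ?_
    rintro _ ⟨μ, rfl, z, hz⟩
    refine EReal.coe_le_coe_iff.2 (le_of_subeigenvector hmono hhom hx0 (fun i => ?_) hz)
    have := exp_le_exp.2 (hx i)
    rw [exp_perturb] at this
    rwa [← exp_le_exp, shift, exp_add, exp_ofReal, Real.exp_neg, inv_mul_le_iff₀ (Real.exp_pos _)]
  · intro r hr
    by_contra hcon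
    obtain ⟨μ, hμ, z, hz⟩ := exists_strict_supereigenvector
      (continuous_perturb (fun _ => r) hcont) (monotone_perturb (fun _ => r) hmono) hcon
    have hle : upperCW F ≤ ((μ - r : ℝ) : EReal) := by
      refine sInf_le ⟨μ - r, rfl, z, fun i => ?_⟩
      have := exp_le_exp.2 (hz i)
      rw [exp_perturb, shift, exp_add, exp_ofReal] at this
      rw [← exp_le_exp, shift, exp_add, exp_ofReal, Real.exp_sub, div_mul_eq_mul_div,
        le_div_iff₀' (Real.exp_pos _)]
      exact this
    have := EReal.coe_lt_coe_iff.1 (hr.trans_le hle)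
    linarith

end

end Trop

/-- The inverses are taken in `[0, +∞]`, and `EReal.abs` sends both `-∞` and `+∞` to `+∞`. -/
theorem mainTheorem2 (n : ℕ) (F : (Fin n → Trop) → (Fin n → Trop))
    (hcont : Continuous F) (hmono : Monotone F) (hhom : Trop.AddHomogeneous F) :
    Trop.condReal F = (Trop.lowerCW F).abs⁻¹ ∧ Trop.cond F = (Trop.upperCW F).abs⁻¹ :=
  ⟨Trop.condReal_eq F, Trop.cond_eq hcont hmono hhom⟩
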